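/- Let $\Phi$ be a finite crystallographic root system (not necessarily irreducible) in a real vector space, with Weyl group $W$ and root lattice $\Lambda_a$ (the additive group generated by $\Phi$), and let $v$ lie in the real span $\mathbb{R}\Lambda_a$. Put $$W^{v+\Lambda_a} := \{\rho \in W : \rho(v) - v \in \Lambda_a\}.$$ Then the subgroup $W^{v+\Lambda_a}$ of $W$ is generated by the reflections $s_\alpha$ ($\alpha\in\Phi$) that it contains. The set $\{\alpha \in \Phi : s_\alpha \in W^{v+\Lambda_a}\}$ is itself a crystallographic root system (in its span), and $W^{v+\Lambda_a}$ is its Weyl group. Moreover, let $W\ltimes\Lambda_a$ be the affine Weyl group, acting by $x \mapsto \rho(x)+\lambda$ for $\rho\in W$, $\lambda\in\Lambda_a$. Then taking linear parts, $(x\mapsto\rho(x)+\lambda)\mapsto\rho$, is an isomorphism from the stabilizer of $v$ in $W\ltimes\Lambda_a$ onto $W^{v+\Lambda_a}$. -/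

import Mathlib

namespace RootPairing

variable {ι R M N : Type*} [CommRing R] [AddCommGroup M] [Module R M] [AddCommGroup N] [Module R N]

/-- The root lattice `Λ_a`: the additive subgroup of `M` generated by the roots. -/
abbrev rootLattice (P : RootPairing ι R M N) : Submodule ℤ M := P.rootSpan ℤ

theorem weylGroup_smul_mem_rootLattice (P : RootPairing ι R M N) (w : P.weylGroup) {x : M}
    (hx : x ∈ P.rootLattice) : w • x ∈ P.rootLattice := by
  induction hx using Submodule.span_induction with
  | mem x hx =>
    obtain ⟨i, rfl⟩ := hx
    rw [weylGroup_apply_root]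
    exact Submodule.subset_span (Set.mem_range_self _)
  | zero => simp
  | add x y _ _ hx hy => rw [smul_add]; exact add_mem hx hy
  | smul n x _ hx => rw [smul_comm]; exact Submodule.smul_mem _ n hx

/-- The action of the Weyl group on the root lattice, restricted from the action on `M`. -/
noncomputable instance rootLatticeAction (P : RootPairing ι R M N) :
    DistribMulAction P.weylGroup P.rootLattice where
  smul w x := ⟨w • (x : M), P.weylGroup_smul_mem_rootLattice w x.2⟩
  one_smul x := Subtype.ext (one_smul P.weylGroup (x : M))
  mul_smul w w' x := Subtype.ext (mul_smul w w' (x : M))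
  smul_zero w := Subtype.ext (smul_zero (A := M) w)
  smul_add w x y := Subtype.ext (smul_add w (x : M) (y : M))

/-- The subgroup `W^{v+Λ_a} = {ρ ∈ W : ρ(v) - v ∈ Λ_a}` of the Weyl group. -/
def congruentialSubgroup (P : RootPairing ι R M N) (v : M) : Subgroup P.weylGroup where
  carrier := {ρ | ρ • v - v ∈ P.rootLattice}
  one_mem' := by simp
  mul_mem' := by
    intro a b ha hb
    have h : (a * b) • v - v = a • (b • v - v) + (a • v - v) := by
      rw [mul_smul, smul_sub]; abel
    change (a * b) • v - v ∈ P.rootLattice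
    rw [h]
    exact add_mem (P.weylGroup_smul_mem_rootLattice a hb) ha
  inv_mem' := by
    intro a ha
    have h : a⁻¹ • v - v = -(a⁻¹ • (a • v - v)) := by
      rw [smul_sub, inv_smul_smul]; abel
    change a⁻¹ • v - v ∈ P.rootLattice
    rw [h]
    exact neg_mem (P.weylGroup_smul_mem_rootLattice _ ha)

theorem weylGroup_ofIdx_reflectionPerm (P : RootPairing ι R M N) (i j : ι) :
    weylGroup.ofIdx P (P.reflectionPerm i j) =
      weylGroup.ofIdx P i * weylGroup.ofIdx P j * weylGroup.ofIdx P i := by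
  apply Subtype.ext
  apply Equiv.weightHom_injective P
  ext x
  change P.reflection (P.reflectionPerm i j) x =
    P.reflection i (P.reflection j (P.reflection i x))
  rw [reflection_reflectionPerm]
  rfl

theorem weylGroup_ofIdx_mul_self (P : RootPairing ι R M N) (i : ι) :
    weylGroup.ofIdx P i * weylGroup.ofIdx P i = 1 := by
  apply Subtype.ext
  apply Equiv.weightHom_injective P
  ext x
  exact P.reflection_same i x

theorem ofIdx_reflectionPerm_mem_iff (P : RootPairing ι R M N) (H : Subgroup P.weylGroup)
    {i : ι} (hi : weylGroup.ofIdx P i ∈ H) (j : ι) :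
    weylGroup.ofIdx P (P.reflectionPerm i j) ∈ H ↔ weylGroup.ofIdx P j ∈ H := by
  rw [weylGroup_ofIdx_reflectionPerm, H.mul_mem_cancel_right hi, H.mul_mem_cancel_left hi]

/-- The root subsystem attached to a subgroup `H` of the Weyl group: the roots whose reflections
lie in `H`, together with their coroots. -/
def subsystem (P : RootPairing ι R M N) (H : Subgroup P.weylGroup) :
    RootPairing {i : ι // weylGroup.ofIdx P i ∈ H} R M N where
  toLinearMap := P.toLinearMap
  root := (Function.Embedding.subtype _).trans P.root
  coroot := (Function.Embedding.subtype _).trans P.coroot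
  root_coroot_two i := P.root_coroot_two i
  reflectionPerm i := Equiv.Perm.subtypePerm (P.reflectionPerm i) (P.ofIdx_reflectionPerm_mem_iff H i.2)
  reflectionPerm_root i j := P.reflectionPerm_root i j
  reflectionPerm_coroot i j := P.reflectionPerm_coroot i j

/-- The group `W⁺ = W ⋉ Λ_a`; the element `⟨λ, w⟩` is to be read as `t_λ ∘ w`. -/
abbrev AffineWeylGroup (P : RootPairing ι R M N) : Type _ :=
  Multiplicative P.rootLattice ⋊[((MulAutMultiplicative P.rootLattice).symm.toMonoidHom.comp
    (DistribMulAction.toAddAut P.weylGroup P.rootLattice))] P.weylGroup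

/-- The action of `W ⋉ Λ_a` on `M` by affine transformations: `⟨λ, w⟩` sends `x` to `w x + λ`. -/
noncomputable instance affineWeylGroupAction (P : RootPairing ι R M N) : MulAction P.AffineWeylGroup M where
  smul g x := g.right • x + ((Multiplicative.toAdd g.left : P.rootLattice) : M)
  one_smul x := by
    change (1 : P.weylGroup) • x + ((0 : P.rootLattice) : M) = x
    simp
  mul_smul g h x := by
    change (g.right * h.right) • x +
        (((Multiplicative.toAdd g.left : P.rootLattice) : M) +
          g.right • ((Multiplicative.toAdd h.left : P.rootLattice) : M)) =
      g.right • (h.right • x + ((Multiplicative.toAdd h.left : P.rootLattice) : M)) +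
        ((Multiplicative.toAdd g.left : P.rootLattice) : M)
    rw [mul_smul, smul_add]
    abel

end RootPairing

namespace RootPairing

variable {ι M N : Type*} [AddCommGroup M] [Module ℝ M] [AddCommGroup N] [Module ℝ N]

/-! An element `ρ` with `ρ v - v ∈ Λ_a` is exactly the linear part of an affine transformation `x ↦
ρ x + (v - ρ v)` in `W ⋉ Λ_a` fixing `v`, and the translation part is forced. This is the stabilizer
isomorphism, and it reduces generation by reflections to a classical fact: the stabilizer of a point
in the affine Weyl group is generated by the affine reflections fixing that point.

That fact (`mem_closure_affineReflection_of_smul_eq`) comes from alcove geometry. Choose a regular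
point `p` so close to `v` that no hyperplane avoiding `v` separates the two. The reflections in the
walls seen from `p` generate the whole group (`affineReflection_mem_closure_isWall`), and words in
them satisfy the exchange property (`exists_list_prod_eq_affineReflection_mul`). Induction on word
length then shows that an element fixing `v` is a product of wall reflections fixing `v`.

The Weyl group of the subsystem is identified with the subgroup by comparing their images in
`GL(M)`. -/

/-! ### Invariance, integrality and faithfulness of the actions -/

theorem coroot'_weylGroup_smul (P : RootPairing ι ℝ M N) (w : P.weylGroup) (i : ι) (x : M) :
    P.coroot' (P.weylGroupToPerm w i) (w • x) = P.coroot' i x := by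
  obtain ⟨w, hw⟩ := w
  induction hw using weylGroup.induction generalizing i x with
  | mem l =>
    change P.coroot' (P.reflectionPerm l i) (P.reflection l x) = _
    rw [coroot'_reflection, reflectionPerm_self]
  | one => rfl
  | mul a b ha hb iha ihb =>
    have h := iha (P.weylGroupToPerm ⟨b, hb⟩ i) ((⟨b, hb⟩ : P.weylGroup) • x)
    rw [ihb] at h
    rw [← h]
    rfl

theorem exists_int_coroot'_of_mem_rootLattice (P : RootPairing ι ℝ M N) [P.IsCrystallographic]
    (i : ι) {x : M} (hx : x ∈ P.rootLattice) : ∃ n : ℤ, P.coroot' i x = n := by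
  induction hx using Submodule.span_induction with
  | mem x hx =>
    obtain ⟨l, rfl⟩ := hx
    obtain ⟨n, hn⟩ := P.exists_value (S := ℤ) l i
    exact ⟨n, hn.symm⟩
  | zero => exact ⟨0, by simp⟩
  | add x y _ _ hx hy =>
    obtain ⟨m, hm⟩ := hx
    obtain ⟨n, hn⟩ := hy
    exact ⟨m + n, by rw [map_add, hm, hn, Int.cast_add]⟩
  | smul a x _ hx =>
    obtain ⟨m, hm⟩ := hx
    exact ⟨a * m, by rw [map_zsmul, hm, zsmul_eq_mul, Int.cast_mul]⟩

theorem weylGroup_eq_of_smul_eq (P : RootPairing ι ℝ M N) {w w' : P.weylGroup}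
    (h : ∀ x : M, w • x = w' • x) : w = w' := by
  apply Subtype.ext
  apply Equiv.weightHom_injective P
  ext x
  exact h x

theorem affineWeylGroup_smul_def (P : RootPairing ι ℝ M N) (g : P.AffineWeylGroup) (x : M) :
    g • x = g.right • x + ((Multiplicative.toAdd g.left : P.rootLattice) : M) :=
  rfl

/-- The value at `0` recovers the translation part. Identities in `W ⋉ Λ_a` can therefore be checked
pointwise on `M`. -/
theorem affineWeylGroup_eq_of_smul_eq (P : RootPairing ι ℝ M N) {g h : P.AffineWeylGroup}
    (H : ∀ x : M, g • x = h • x) : g = h := by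
  have hl : ((Multiplicative.toAdd g.left : P.rootLattice) : M) =
      ((Multiplicative.toAdd h.left : P.rootLattice) : M) := by
    simpa [affineWeylGroup_smul_def] using H 0
  refine SemidirectProduct.ext (Subtype.ext hl) (P.weylGroup_eq_of_smul_eq fun x ↦ ?_)
  have := H x
  rwa [affineWeylGroup_smul_def, affineWeylGroup_smul_def, hl, add_left_inj] at this

/-! ### Affine roots and affine reflections -/

/-- The affine function `x ↦ ⟨x, αᵢ^∨⟩ - k` attached to the affine root `(i, k)`. -/
noncomputable def affineCoord (P : RootPairing ι ℝ M N) (j : ι × ℤ) (x : M) : ℝ :=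
  P.coroot' j.1 x - j.2

/-- The reflection in the zero locus of `affineCoord`, as an element of `W ⋉ Λ_a`. -/
noncomputable def affineReflection (P : RootPairing ι ℝ M N) (j : ι × ℤ) : P.AffineWeylGroup :=
  ⟨Multiplicative.ofAdd ⟨j.2 • P.root j.1,
    Submodule.smul_mem _ _ (Submodule.subset_span (Set.mem_range_self _))⟩, weylGroup.ofIdx P j.1⟩

theorem affineReflection_smul (P : RootPairing ι ℝ M N) (j : ι × ℤ) (x : M) :
    P.affineReflection j • x = x - P.affineCoord j x • P.root j.1 := by
  change P.reflection j.1 x + j.2 • P.root j.1 = _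
  rw [reflection_apply, affineCoord, sub_smul, Int.cast_smul_eq_zsmul]
  abel

theorem affineCoord_affineReflection_smul (P : RootPairing ι ℝ M N) (j j' : ι × ℤ) (x : M) :
    P.affineCoord j' (P.affineReflection j • x) =
      P.affineCoord j' x - P.pairing j.1 j'.1 * P.affineCoord j x := by
  simp only [affineReflection_smul, affineCoord]
  rw [map_sub, map_smul, root_coroot'_eq_pairing,
    smul_eq_mul]
  ring

theorem affineCoord_affineReflection_smul_self (P : RootPairing ι ℝ M N) (j : ι × ℤ) (x : M) :
    P.affineCoord j (P.affineReflection j • x) = -P.affineCoord j x := by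
  rw [affineCoord_affineReflection_smul, pairing_same]
  ring

theorem affineReflection_mul_self (P : RootPairing ι ℝ M N) (j : ι × ℤ) :
    P.affineReflection j * P.affineReflection j = 1 := by
  refine P.affineWeylGroup_eq_of_smul_eq fun x ↦ ?_
  rw [mul_smul, affineReflection_smul, affineCoord_affineReflection_smul_self,
    affineReflection_smul, one_smul]
  simp

theorem affineReflection_inv (P : RootPairing ι ℝ M N) (j : ι × ℤ) :
    (P.affineReflection j)⁻¹ = P.affineReflection j :=
  inv_eq_of_mul_eq_one_left (P.affineReflection_mul_self j)

theorem affineReflection_smul_eq_self (P : RootPairing ι ℝ M N) {j : ι × ℤ} {x : M}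
    (h : P.affineCoord j x = 0) : P.affineReflection j • x = x := by
  rw [affineReflection_smul, h, zero_smul, sub_zero]

theorem exists_affineCoord_neg (P : RootPairing ι ℝ M N) (j : ι × ℤ) :
    ∃ j' : ι × ℤ, (∀ x, P.affineCoord j' x = -P.affineCoord j x) ∧
      P.affineReflection j' = P.affineReflection j ∧ P.root j'.1 = -P.root j.1 := by
  have hf (x : M) : P.affineCoord (P.reflectionPerm j.1 j.1, -j.2) x = -P.affineCoord j x := by
    simp only [affineCoord]
    rw [← coroot'_reflection, reflection_apply, map_sub, map_smul, root_coroot'_eq_pairing,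
      pairing_same, smul_eq_mul]
    push_cast
    ring
  have hroot : P.root (P.reflectionPerm j.1 j.1) = -P.root j.1 := by
    rw [root_reflectionPerm, reflection_apply_self]
  refine ⟨_, hf, P.affineWeylGroup_eq_of_smul_eq fun x ↦ ?_, hroot⟩
  rw [affineReflection_smul, affineReflection_smul, hf, hroot, neg_smul_neg]

/-- Affine roots are permuted because a translation in `Λ_a` shifts the level `k` by a value of a
coroot on the lattice, an integer in the crystallographic case. -/
theorem exists_affineCoord_smul (P : RootPairing ι ℝ M N) [P.IsCrystallographic]
    (g : P.AffineWeylGroup) (j : ι × ℤ) :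
    ∃ j' : ι × ℤ, (∀ x : M, P.affineCoord j' (g • x) = P.affineCoord j x) ∧
      P.affineReflection j' = g * P.affineReflection j * g⁻¹ ∧
      P.root j'.1 = g.right • P.root j.1 := by
  obtain ⟨n, hn⟩ := P.exists_int_coroot'_of_mem_rootLattice (P.weylGroupToPerm g.right j.1)
    (Multiplicative.toAdd g.left).2
  have hf (x : M) : P.affineCoord (P.weylGroupToPerm g.right j.1, j.2 + n) (g • x) =
      P.affineCoord j x := by
    simp only [affineCoord]
    rw [affineWeylGroup_smul_def, map_add, coroot'_weylGroup_smul, hn]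
    push_cast
    ring
  refine ⟨_, hf, eq_mul_inv_of_mul_eq (P.affineWeylGroup_eq_of_smul_eq fun x ↦ ?_),
    (P.weylGroup_apply_root _ _).symm⟩
  rw [mul_smul, mul_smul, affineReflection_smul, hf, affineReflection_smul,
    affineWeylGroup_smul_def, affineWeylGroup_smul_def, smul_sub, smul_comm, weylGroup_apply_root]
  abel

theorem closure_range_affineReflection (P : RootPairing ι ℝ M N) :
    Subgroup.closure (Set.range P.affineReflection) = ⊤ := by
  set H := Subgroup.closure (Set.range P.affineReflection)
  have hmem (j : ι × ℤ) : P.affineReflection j ∈ H := Subgroup.subset_closure (Set.mem_range_self j)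
  have hright (w : P.weylGroup) : (SemidirectProduct.inr w : P.AffineWeylGroup) ∈ H := by
    obtain ⟨w, hw⟩ := w
    induction hw using weylGroup.induction with
    | mem i =>
      convert hmem (i, 0) using 1
      refine P.affineWeylGroup_eq_of_smul_eq fun x ↦ ?_
      rw [affineWeylGroup_smul_def, affineWeylGroup_smul_def]
      change _ + (0 : M) = _ + (0 : ℤ) • P.root i
      rw [zero_smul]
      rfl
    | one => exact H.one_mem
    | mul a b ha hb iha ihb =>
      convert H.mul_mem iha ihb using 1
      rw [← map_mul]
      rfl
  have htrans (i : ι) (y : P.rootLattice) (hy : (y : M) = P.root i) :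
      (SemidirectProduct.inl (Multiplicative.ofAdd y) : P.AffineWeylGroup) ∈ H := by
    -- Reflecting in two parallel hyperplanes of consecutive levels translates by the root.
    convert H.mul_mem (hmem (i, 1)) (hmem (i, 0)) using 1
    refine P.affineWeylGroup_eq_of_smul_eq fun x ↦ ?_
    rw [mul_smul, affineReflection_smul, affineCoord_affineReflection_smul, affineReflection_smul,
      affineWeylGroup_smul_def]
    change (1 : P.weylGroup) • x + (y : M) = _
    simp only [pairing_same, affineCoord, hy, one_smul]
    module
  have hleft (y : M) (hy : y ∈ P.rootLattice) :
      (SemidirectProduct.inl (Multiplicative.ofAdd ⟨y, hy⟩) : P.AffineWeylGroup) ∈ H := by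
    induction hy using Submodule.span_induction with
    | mem x hx =>
      obtain ⟨i, rfl⟩ := hx
      exact htrans i _ rfl
    | zero => exact H.one_mem
    | add x y hx hy ihx ihy =>
      convert H.mul_mem ihx ihy using 1
      rw [← map_mul]
      rfl
    | smul a x hx ih =>
      convert H.zpow_mem ih a using 1
      rw [← map_zpow]
      rfl
  refine eq_top_iff.mpr fun g _ ↦ ?_
  rw [← SemidirectProduct.inl_left_mul_inr_right g]
  exact H.mul_mem (hleft _ (Multiplicative.toAdd g.left).2) (hright g.right)

/-! ### Lengths, angles and distances for the canonical form -/

/-- The length of a root for the canonical invariant form. -/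
noncomputable def rootNorm [Fintype ι] (P : RootPairing ι ℝ M N) (i : ι) : ℝ :=
  √(P.RootForm (P.root i) (P.root i))

/-- The cosine of the angle between two roots for the canonical invariant form. -/
noncomputable def rootCos [Fintype ι] (P : RootPairing ι ℝ M N) (i j : ι) : ℝ :=
  P.RootForm (P.root i) (P.root j) / (P.rootNorm i * P.rootNorm j)

theorem rootForm_root_self_pos' [Fintype ι] (P : RootPairing ι ℝ M N) (i : ι) :
    0 < P.RootForm (P.root i) (P.root i) :=
  P.rootForm_pos_of_ne_zero (Submodule.subset_span (Set.mem_range_self i)) (P.ne_zero i)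

theorem rootNorm_pos [Fintype ι] (P : RootPairing ι ℝ M N) (i : ι) : 0 < P.rootNorm i :=
  Real.sqrt_pos.mpr (P.rootForm_root_self_pos' i)

theorem rootNorm_mul_self [Fintype ι] (P : RootPairing ι ℝ M N) (i : ι) :
    P.rootNorm i * P.rootNorm i = P.RootForm (P.root i) (P.root i) :=
  Real.mul_self_sqrt (P.rootForm_root_self_pos' i).le

theorem rootForm_eq_rootCos_mul [Fintype ι] (P : RootPairing ι ℝ M N) (i j : ι) :
    P.RootForm (P.root i) (P.root j) = P.rootCos i j * (P.rootNorm i * P.rootNorm j) :=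
  (div_mul_cancel₀ _ (mul_pos (P.rootNorm_pos i) (P.rootNorm_pos j)).ne').symm

theorem rootForm_symm_apply [Fintype ι] (P : RootPairing ι ℝ M N) (x y : M) :
    P.RootForm x y = P.RootForm y x := by
  simp only [rootForm_apply_apply, mul_comm]

theorem rootCos_comm [Fintype ι] (P : RootPairing ι ℝ M N) (i j : ι) :
    P.rootCos i j = P.rootCos j i := by
  rw [rootCos, rootCos, rootForm_symm_apply, mul_comm (P.rootNorm i)]

theorem rootCos_le_one [Fintype ι] (P : RootPairing ι ℝ M N) (i j : ι) : P.rootCos i j ≤ 1 := by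
  have h := LinearMap.BilinForm.apply_sq_le_of_symm P.RootForm P.zero_le_rootForm
    P.rootForm_symmetric (P.root i) (P.root j)
  have hij := mul_pos (P.rootNorm_pos i) (P.rootNorm_pos j)
  refine (div_le_one hij).mpr (abs_le_of_sq_le_sq' ?_ hij.le).2
  rw [← rootNorm_mul_self, ← rootNorm_mul_self] at h
  linarith

theorem rootNorm_mul_rootNorm_mul_coroot' [Fintype ι] (P : RootPairing ι ℝ M N) (i : ι) (x : M) :
    P.rootNorm i * (P.rootNorm i * P.coroot' i x) = 2 * P.RootForm (P.root i) x := by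
  have h := congrArg (P.toLinearMap x) (P.rootForm_self_smul_coroot i)
  rw [map_smul, map_nsmul, toLinearMap_apply_apply_Polarization, ← rootNorm_mul_self] at h
  simpa [mul_assoc] using h

theorem rootNorm_mul_pairing [Fintype ι] (P : RootPairing ι ℝ M N) (i j : ι) :
    P.rootNorm j * P.pairing i j = 2 * P.rootCos i j * P.rootNorm i := by
  have h := P.rootNorm_mul_rootNorm_mul_coroot' j (P.root i)
  rw [root_coroot'_eq_pairing, rootForm_eq_rootCos_mul, rootCos_comm] at h
  apply mul_left_cancel₀ (P.rootNorm_pos j).ne'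
  linarith

/-- Equality case of Cauchy–Schwarz: the difference is isotropic and lies in the root span, where
the form is definite. -/
theorem rootNorm_smul_root_eq_of_rootCos_eq_one [Fintype ι] (P : RootPairing ι ℝ M N) {i j : ι}
    (h : P.rootCos i j = 1) : P.rootNorm j • P.root i = P.rootNorm i • P.root j := by
  rw [← sub_eq_zero]
  apply P.eq_zero_of_mem_rootSpan_of_rootForm_self_eq_zero
  · exact sub_mem (Submodule.smul_mem _ _ (Submodule.subset_span (Set.mem_range_self i)))
      (Submodule.smul_mem _ _ (Submodule.subset_span (Set.mem_range_self j)))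
  · have hij := P.rootForm_eq_rootCos_mul i j
    rw [h, one_mul] at hij
    simp only [map_sub, map_smul, LinearMap.sub_apply, LinearMap.smul_apply, smul_eq_mul,
      ← rootNorm_mul_self, P.rootForm_symm_apply (P.root j) (P.root i), hij]
    ring

/-- Twice the signed distance from `x` to the hyperplane of an affine root. -/
noncomputable def affineDist [Fintype ι] (P : RootPairing ι ℝ M N) (j : ι × ℤ) (x : M) : ℝ :=
  P.rootNorm j.1 * P.affineCoord j x

theorem affineDist_pos_iff [Fintype ι] (P : RootPairing ι ℝ M N) {j : ι × ℤ} {x : M} :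
    0 < P.affineDist j x ↔ 0 < P.affineCoord j x :=
  mul_pos_iff_of_pos_left (P.rootNorm_pos j.1)

/-- Scaling by root length turns the asymmetric pairing into twice a cosine, which makes distances
to different hyperplanes comparable. -/
theorem affineDist_affineReflection_smul [Fintype ι] (P : RootPairing ι ℝ M N) (j j' : ι × ℤ)
    (x : M) : P.affineDist j' (P.affineReflection j • x) =
      P.affineDist j' x - 2 * P.rootCos j.1 j'.1 * P.affineDist j x := by
  rw [affineDist, affineCoord_affineReflection_smul, mul_sub, ← mul_assoc, rootNorm_mul_pairing,
    affineDist, affineDist]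
  ring

/-- Parallel hyperplanes at the same signed distance from one point coincide. Only the reflections
are equated: in a non-reduced system, distinct affine roots can share a hyperplane. -/
theorem affineReflection_eq_of_affineDist_eq [Fintype ι] (P : RootPairing ι ℝ M N) {j j' : ι × ℤ}
    (h : P.rootCos j.1 j'.1 = 1) {p : M} (hp : P.affineDist j p = P.affineDist j' p) :
    P.affineReflection j = P.affineReflection j' := by
  have hroot := P.rootNorm_smul_root_eq_of_rootCos_eq_one h
  have h0 := (P.rootNorm_pos j.1).ne'
  have h0' := (P.rootNorm_pos j'.1).ne'
  have hlin (x : M) : P.rootNorm j.1 * P.coroot' j.1 x = P.rootNorm j'.1 * P.coroot' j'.1 x := by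
    have h1 := P.rootNorm_mul_rootNorm_mul_coroot' j.1 x
    have h2 := P.rootNorm_mul_rootNorm_mul_coroot' j'.1 x
    have h3 := congrArg (fun y ↦ P.RootForm y x) hroot
    simp only [map_smul, LinearMap.smul_apply, smul_eq_mul] at h3
    apply mul_left_cancel₀ (mul_ne_zero h0 h0')
    linear_combination P.rootNorm j'.1 * h1 - P.rootNorm j.1 * h2 + 2 * h3
  have hdist (x : M) : P.affineDist j x = P.affineDist j' x := by
    have h1 := hlin x
    have h2 := hlin p
    simp only [affineDist, affineCoord] at hp ⊢
    linear_combination h1 - h2 + hp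
  refine P.affineWeylGroup_eq_of_smul_eq fun x ↦ ?_
  rw [affineReflection_smul, affineReflection_smul, sub_right_inj]
  apply smul_right_injective M h0'
  have := hdist x
  simp only [affineDist] at this
  dsimp only
  rw [smul_comm, hroot, smul_smul, smul_smul, ← this, mul_comm]

theorem finite_setOf_abs_affineDist_lt [Fintype ι] (P : RootPairing ι ℝ M N) (x : M) (b : ℝ) :
    {j : ι × ℤ | |P.affineDist j x| < b}.Finite := by
  refine (Set.finite_iUnion fun i : ι ↦ (Set.finite_Icc ⌊P.coroot' i x - b / P.rootNorm i⌋
    ⌈P.coroot' i x + b / P.rootNorm i⌉).image (Prod.mk i)).subset ?_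
  rintro ⟨i, k⟩ h
  refine Set.mem_iUnion.mpr ⟨i, k, ?_, rfl⟩
  have h1 : |P.coroot' i x - k| < b / P.rootNorm i := by
    rw [lt_div_iff₀' (P.rootNorm_pos i)]
    rwa [← abs_of_pos (P.rootNorm_pos i), ← abs_mul]
  rw [abs_lt] at h1
  have h2 : (⌊P.coroot' i x - b / P.rootNorm i⌋ : ℝ) ≤ k :=
    (Int.floor_le _).trans (by linarith)
  have h3 : (k : ℝ) ≤ ⌈P.coroot' i x + b / P.rootNorm i⌉ :=
    le_trans (by linarith) (Int.le_ceil _)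
  exact ⟨by exact_mod_cast h2, by exact_mod_cast h3⟩

/-! ### Walls and generation by wall reflections -/

/-- The point `x` lies on none of the affine reflection hyperplanes. -/
def IsAffineRegular (P : RootPairing ι ℝ M N) (x : M) : Prop :=
  ∀ j : ι × ℤ, P.affineCoord j x ≠ 0

/-- The affine root `j` is positive at `p`, and its reflection hyperplane is the only one that
separates `p` from its mirror image. -/
def IsWall (P : RootPairing ι ℝ M N) (p : M) (j : ι × ℤ) : Prop :=
  0 < P.affineCoord j p ∧ ∀ j' : ι × ℤ, 0 < P.affineCoord j' p →
    P.affineCoord j' (P.affineReflection j • p) < 0 → P.affineReflection j' = P.affineReflection j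

theorem rootForm_weylGroup_smul [Fintype ι] (P : RootPairing ι ℝ M N) (w : P.weylGroup)
    (x y : M) : P.RootForm (w • x) (w • y) = P.RootForm x y :=
  InvariantForm.apply_weylGroup_smul P (B := P.toInvariantForm) w x y

theorem rootNorm_eq_of_smul_eq [Fintype ι] (P : RootPairing ι ℝ M N) {i j : ι} (w : P.weylGroup)
    (h : P.root j = w • P.root i) : P.rootNorm j = P.rootNorm i := by
  rw [rootNorm, h, rootForm_weylGroup_smul, rootNorm]

theorem rootNorm_eq_of_neg_eq [Fintype ι] (P : RootPairing ι ℝ M N) {i j : ι}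
    (h : P.root j = -P.root i) : P.rootNorm j = P.rootNorm i := by
  rw [rootNorm, h, map_neg, map_neg, LinearMap.neg_apply, neg_neg, rootNorm]

/-- With `n = s_m j` one has `d_n = d_j - 2 cos(m, j) d_m`, and `0 < 2 cos(m, j) d_m < 2 d_j`, so
`|d_n| < d_j`. Hence `s_j = s_m s_n s_m` is a product of reflections in closer hyperplanes. -/
theorem affineReflection_mem_of_forall_abs_lt [Fintype ι] (P : RootPairing ι ℝ M N)
    [P.IsCrystallographic] {p : M} {H : Subgroup P.AffineWeylGroup} {j m : ι × ℤ}
    (hj : 0 < P.affineDist j p)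
    (ih : ∀ j', |P.affineDist j' p| < |P.affineDist j p| → P.affineReflection j' ∈ H)
    (hm : 0 < P.affineDist m p) (hmj : P.affineDist m p < P.affineDist j p)
    (hc : 0 < P.rootCos m.1 j.1) : P.affineReflection j ∈ H := by
  obtain ⟨n, hn, hn', hroot⟩ := P.exists_affineCoord_smul (P.affineReflection m) j
  have hmH : P.affineReflection m ∈ H := ih m (by rwa [abs_of_pos hm, abs_of_pos hj])
  have hdist : P.affineDist n p =
      P.affineDist j p - 2 * P.rootCos m.1 j.1 * P.affineDist m p := by
    rw [← affineDist_affineReflection_smul, affineDist, affineDist,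
      P.rootNorm_eq_of_smul_eq _ hroot, ← hn, ← mul_smul, affineReflection_mul_self, one_smul]
  have hnH : P.affineReflection n ∈ H := by
    refine ih n ?_
    have h1 := P.rootCos_le_one m.1 j.1
    have h2 := mul_pos hc hm
    have h3 := mul_le_of_le_one_left hm.le h1
    rw [abs_of_pos hj, hdist, abs_lt]
    constructor <;> linarith
  rw [hn', affineReflection_inv] at hnH
  exact (H.mul_mem_cancel_left hmH).mp ((H.mul_mem_cancel_right hmH).mp hnH)

theorem exists_affineCoord_pos [Fintype ι] (P : RootPairing ι ℝ M N) {p : M}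
    (hp : P.IsAffineRegular p) (j : ι × ℤ) :
    ∃ j' : ι × ℤ, 0 < P.affineCoord j' p ∧ P.affineReflection j' = P.affineReflection j ∧
      |P.affineDist j' p| = |P.affineDist j p| := by
  rcases (hp j).lt_or_gt with h | h
  · obtain ⟨j', hj', ht, hroot⟩ := P.exists_affineCoord_neg j
    refine ⟨j', by rw [hj']; linarith, ht, ?_⟩
    rw [affineDist, affineDist, hj', P.rootNorm_eq_of_neg_eq hroot, mul_neg, abs_neg]
  · exact ⟨j, h, rfl, rfl⟩

/-- Induction on how many affine roots are strictly closer to `p`, a finite number by discreteness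
of the levels. -/
theorem affineReflection_mem_closure_isWall [Fintype ι] (P : RootPairing ι ℝ M N)
    [P.IsCrystallographic] {p : M} (hp : P.IsAffineRegular p) (j : ι × ℤ) :
    P.affineReflection j ∈ Subgroup.closure (P.affineReflection '' {j | P.IsWall p j}) := by
  set H := Subgroup.closure (P.affineReflection '' {j | P.IsWall p j})
  induction hcard : {j' : ι × ℤ | |P.affineDist j' p| < |P.affineDist j p|}.ncard using
    Nat.strong_induction_on generalizing j with
  | _ c ihc =>
  subst hcard
  have ih (j' : ι × ℤ) (hj' : |P.affineDist j' p| < |P.affineDist j p|) :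
      P.affineReflection j' ∈ H := by
    refine ihc _ (Set.ncard_lt_ncard ⟨fun l hl ↦ lt_trans hl hj', fun h ↦ ?_⟩
      (P.finite_setOf_abs_affineDist_lt p _)) j' rfl
    exact lt_irrefl |P.affineDist j' p| (h hj')
  obtain ⟨i, hj, ht, habs⟩ := P.exists_affineCoord_pos hp j
  rw [← ht]
  rw [← habs] at ih
  clear ihc ht habs j
  rename' i => j
  by_cases hw : P.IsWall p j
  · exact Subgroup.subset_closure ⟨j, hw, rfl⟩
  obtain ⟨l, hl, hl', hne⟩ : ∃ l : ι × ℤ, 0 < P.affineCoord l p ∧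
      P.affineCoord l (P.affineReflection j • p) < 0 ∧
      P.affineReflection l ≠ P.affineReflection j := by
    by_contra! h
    exact hw ⟨hj, h⟩
  -- Put `k = -s_j l`. Then `d_l + d_k = 2 cos(l, j) d_j ≤ 2 d_j`, so `l` or `k` is closer to `p`
  -- than `j`, except when both distances equal `d_j` and the cosine is `1`.
  obtain ⟨n, hn, -, hnroot⟩ := P.exists_affineCoord_smul (P.affineReflection j) l
  obtain ⟨k, hk, -, hkroot⟩ := P.exists_affineCoord_neg n
  rw [← affineDist_pos_iff] at hj hl
  have hkp : P.affineCoord k p = -P.affineCoord l (P.affineReflection j • p) := by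
    rw [hk, ← hn, ← mul_smul, affineReflection_mul_self, one_smul]
  have hknorm : P.rootNorm k.1 = P.rootNorm l.1 := by
    rw [P.rootNorm_eq_of_neg_eq hkroot, P.rootNorm_eq_of_smul_eq _ hnroot]
  have hkpos : 0 < P.affineDist k p := by
    rw [affineDist_pos_iff, hkp]
    linarith
  have hkdist : P.affineDist k p =
      2 * P.rootCos l.1 j.1 * P.affineDist j p - P.affineDist l p := by
    have h := P.affineDist_affineReflection_smul j l p
    rw [rootCos_comm] at h
    rw [affineDist, hkp, hknorm, mul_neg, ← affineDist, h]
    ring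
  have hc : 0 < P.rootCos l.1 j.1 := by
    by_contra! hc
    have := mul_nonpos_of_nonpos_of_nonneg hc hj.le
    linarith
  have hc1 := P.rootCos_le_one l.1 j.1
  by_cases h1 : P.affineDist l p < P.affineDist j p
  · exact P.affineReflection_mem_of_forall_abs_lt hj ih hl h1 hc
  by_cases h2 : P.affineDist k p < P.affineDist j p
  · refine P.affineReflection_mem_of_forall_abs_lt hj ih hkpos h2 ?_
    have hjneg : (P.affineReflection j).right • P.root j.1 = -P.root j.1 :=
      P.reflection_apply_self j.1
    have hform : P.RootForm (P.root k.1) (P.root j.1) = P.RootForm (P.root l.1) (P.root j.1) := by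
      rw [← neg_neg (P.root j.1), ← hjneg, hkroot, hnroot, map_neg, LinearMap.map_neg₂, neg_neg,
        rootForm_weylGroup_smul, hjneg, neg_neg]
    rwa [rootCos, hform, hknorm]
  -- In the exceptional case `l` and `j` define the same reflection, contrary to the choice of `l`.
  · exfalso
    have hprod := mul_le_of_le_one_left hj.le hc1
    refine hne (P.affineReflection_eq_of_affineDist_eq (p := p) ?_ (by linarith))
    apply le_antisymm hc1
    by_contra! hlt
    have := mul_lt_of_lt_one_left hj hlt
    linarith

/-! ### Exchange property for words -/

/-- The exchange property for words in wall reflections. -/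
theorem exists_list_prod_eq_affineReflection_mul (P : RootPairing ι ℝ M N) [P.IsCrystallographic]
    {p : M} (hp : P.IsAffineRegular p) (l : List P.AffineWeylGroup)
    (hl : ∀ t ∈ l, t ∈ P.affineReflection '' {j | P.IsWall p j}) (j : ι × ℤ)
    (hj : 0 < P.affineCoord j p) (hj' : P.affineCoord j (l.prod • p) < 0) :
    ∃ l' : List P.AffineWeylGroup, (∀ t ∈ l', t ∈ P.affineReflection '' {j | P.IsWall p j}) ∧
      l'.length + 1 = l.length ∧ l'.prod = P.affineReflection j * l.prod := by
  induction l generalizing j with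
  | nil =>
    rw [List.prod_nil, one_smul] at hj'
    exact absurd hj' hj.not_gt
  | cons t l ih =>
    obtain ⟨s, hs, rfl⟩ := hl t List.mem_cons_self
    have hl' : ∀ t ∈ l, t ∈ P.affineReflection '' {j | P.IsWall p j} :=
      fun t ht ↦ hl t (List.mem_cons_of_mem _ ht)
    rw [List.prod_cons] at hj' ⊢
    -- If the first letter already crosses the hyperplane of `j`, the wall property gives `s_j =
    -- s_s` and that letter is deleted. Otherwise the crossing is carried back by `s_s` to the rest
    -- of the word.
    by_cases h : P.affineCoord j (P.affineReflection s • p) < 0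
    · refine ⟨l, hl', rfl, ?_⟩
      rw [hs.2 j hj h, ← mul_assoc, affineReflection_mul_self, one_mul]
    · obtain ⟨n, hn, hn', -⟩ := P.exists_affineCoord_smul (P.affineReflection s) j
      have hcoord (x : M) : P.affineCoord n x = P.affineCoord j (P.affineReflection s • x) := by
        rw [← hn, ← mul_smul, affineReflection_mul_self, one_smul]
      obtain ⟨l', hw, hlen, hprod⟩ := ih hl' n
        ((hcoord p ▸ not_lt.mp h).lt_of_ne (hp n).symm) (by rwa [hcoord, ← mul_smul])
      refine ⟨P.affineReflection s :: l', ?_, by simp [hlen], ?_⟩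
      · rintro t (_ | ⟨_, ht⟩)
        exacts [⟨s, hs, rfl⟩, hw t ht]
      · rw [List.prod_cons, hprod, hn', affineReflection_inv]
        simp only [← mul_assoc, affineReflection_mul_self, one_mul]

theorem exists_list_isWall_prod_eq [Fintype ι] (P : RootPairing ι ℝ M N) [P.IsCrystallographic]
    {p : M} (hp : P.IsAffineRegular p) (g : P.AffineWeylGroup) :
    ∃ l : List P.AffineWeylGroup,
      (∀ t ∈ l, t ∈ P.affineReflection '' {j | P.IsWall p j}) ∧ l.prod = g := by
  have hg : g ∈ Subgroup.closure (P.affineReflection '' {j | P.IsWall p j}) := by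
    have htop : g ∈ Subgroup.closure (Set.range P.affineReflection) := by
      rw [closure_range_affineReflection]
      exact Subgroup.mem_top g
    refine (Subgroup.closure_le _).mpr ?_ htop
    rintro - ⟨j, rfl⟩
    exact P.affineReflection_mem_closure_isWall hp j
  rw [← Subgroup.mem_toSubmonoid, Subgroup.closure_toSubmonoid] at hg
  obtain ⟨l, hl, rfl⟩ := Submonoid.exists_list_of_mem_closure hg
  refine ⟨l, fun t ht ↦ (hl t ht).elim id ?_, rfl⟩
  rintro ⟨j, hj, hjt⟩
  exact ⟨j, hj, by rw [← inv_inv t, ← hjt, affineReflection_inv]⟩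

/-! ### Stabilizers of points -/

/-- Near any point there is a regular point that lies on the same side of every affine reflection
hyperplane that avoids the given point. -/
theorem exists_isAffineRegular_near [Finite ι] (P : RootPairing ι ℝ M N) (v : M) :
    ∃ p : M, P.IsAffineRegular p ∧
      ∀ j : ι × ℤ, P.affineCoord j v ≠ 0 → 0 < P.affineCoord j v * P.affineCoord j p := by
  obtain ⟨u, -, hu⟩ := Module.Dual.exists_forall_mem_ne_zero_of_forall_exists (⊤ : Submodule ℝ M)
    P.coroot' fun i ↦ ⟨P.root i, Submodule.mem_top, by
      rw [root_coroot'_eq_pairing, pairing_same]; norm_num⟩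
  have key (i : ι) : ∀ᶠ ε : ℝ in nhds 0, ∀ k : ℤ, P.coroot' i v - k ≠ 0 →
      0 < (P.coroot' i v - k) * (P.coroot' i v - k + ε * P.coroot' i u) := by
    set a := P.coroot' i v
    set b := P.coroot' i u
    -- The integers other than `a` form a closed set, so a single `δ` bounds `|a - k|` below for all
    -- of them.
    have hclosed : IsClosed (((↑) : ℤ → ℝ) '' {k | a ≠ k}) :=
      Int.isClosedEmbedding_coe_real.isClosedMap _ (isClosed_discrete _)
    obtain ⟨δ, hδ, hball⟩ := Metric.isOpen_iff.mp hclosed.isOpen_compl a <| by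
      rintro ⟨k, hk, hka⟩
      exact hk hka.symm
    have htend : Filter.Tendsto (fun ε : ℝ ↦ |ε * b|) (nhds 0) (nhds 0) :=
      Continuous.tendsto' (by fun_prop) _ _ (by simp)
    filter_upwards [htend.eventually_lt_const hδ] with ε hε k hk
    have hak : δ ≤ |a - k| := by
      by_contra! h
      refine hball (a := (k : ℝ)) ?_ ⟨k, sub_ne_zero.mp hk, rfl⟩
      rwa [Metric.mem_ball, dist_comm, Real.dist_eq]
    have hlt : |ε * b| < |a - k| := hε.trans_le hak
    have h1 := mul_lt_mul_of_pos_left hlt (abs_pos.mpr hk)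
    rw [← abs_mul, abs_mul_abs_self] at h1
    have h2 := neg_abs_le ((a - k) * (ε * b))
    linarith
  obtain ⟨ε, hε, hεpos⟩ := (((Filter.eventually_all.mpr key).filter_mono nhdsWithin_le_nhds).and
    (self_mem_nhdsWithin (a := (0 : ℝ)) (s := Set.Ioi 0))).exists
  have hcoord (j : ι × ℤ) :
      P.affineCoord j (v + ε • u) = P.coroot' j.1 v - j.2 + ε * P.coroot' j.1 u := by
    rw [affineCoord, map_add, map_smul, smul_eq_mul]
    ring
  have hside (j : ι × ℤ) (hj : P.affineCoord j v ≠ 0) :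
      0 < P.affineCoord j v * P.affineCoord j (v + ε • u) := by
    rw [hcoord]
    exact hε j.1 j.2 hj
  refine ⟨v + ε • u, fun j ↦ ?_, hside⟩
  by_cases hj : P.affineCoord j v = 0
  · rw [hcoord, ← affineCoord, hj, zero_add]
    exact mul_ne_zero (ne_of_gt hεpos) (hu j.1)
  · exact right_ne_zero_of_mul (hside j hj).ne'

theorem mem_closure_affineReflection_of_smul_eq [Finite ι] (P : RootPairing ι ℝ M N)
    [P.IsCrystallographic] {v : M} {g : P.AffineWeylGroup} (hg : g • v = v) :
    g ∈ Subgroup.closure (P.affineReflection '' {j | P.affineCoord j v = 0}) := by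
  cases nonempty_fintype ι
  obtain ⟨p, hp, hpv⟩ := P.exists_isAffineRegular_near v
  obtain ⟨l, hl, rfl⟩ := P.exists_list_isWall_prod_eq hp g
  set H := Subgroup.closure (P.affineReflection '' {j | P.affineCoord j v = 0})
  induction hlen : l.length using Nat.strong_induction_on generalizing l with
  | _ n ih =>
  subst hlen
  rcases l with _ | ⟨t, l⟩
  · exact H.one_mem
  obtain ⟨s, hs, rfl⟩ := hl t List.mem_cons_self
  have hl' : ∀ t ∈ l, t ∈ P.affineReflection '' {j | P.IsWall p j} :=
    fun t ht ↦ hl t (List.mem_cons_of_mem _ ht)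
  rw [List.prod_cons] at hg ⊢
  have hprod : P.affineReflection s * (P.affineReflection s * l.prod) = l.prod := by
    rw [← mul_assoc, affineReflection_mul_self, one_mul]
  have hcoord : P.affineCoord s (l.prod • p) =
      -P.affineCoord s ((P.affineReflection s * l.prod) • p) := by
    rw [← affineCoord_affineReflection_smul_self, ← mul_smul, hprod]
  by_cases h : P.affineCoord s (l.prod • p) < 0
  -- Exchange rewrites the product as a word two letters shorter.
  · obtain ⟨l', hw, hlen, hl'prod⟩ :=
      P.exists_list_prod_eq_affineReflection_mul hp l hl' s hs.1 h
    rw [← hl'prod] at hg ⊢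
    exact ih l'.length (by simp; omega) l' hw hg rfl
  · have hneg : P.affineCoord s ((P.affineReflection s * l.prod) • p) ≤ 0 := by linarith
    -- Otherwise `s` is positive at `v`, as it is at `p`. Its transform `n` under the inverse of the
    -- word has the same value at the fixed point `v`, but is nonpositive at `p`, contradicting the
    -- choice of `p`.
    have hsv : P.affineCoord s v = 0 := by
      by_contra hsv
      obtain ⟨n, hn, -⟩ :=
        P.exists_affineCoord_smul (P.affineReflection s * l.prod)⁻¹ s
      have hnv : P.affineCoord n v = P.affineCoord s v := by
        have := hn v
        rwa [inv_smul_eq_iff.mpr hg.symm] at this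
      have hnp := hn ((P.affineReflection s * l.prod) • p)
      rw [inv_smul_smul] at hnp
      have h1 := hpv n (hnv ▸ hsv)
      rw [hnv, hnp] at h1
      have h2 := pos_of_mul_pos_left (hpv s hsv) hs.1.le
      exact absurd h1 (mul_nonpos_of_nonneg_of_nonpos h2.le hneg).not_gt
    have hsH : P.affineReflection s ∈ H := Subgroup.subset_closure ⟨s, hsv, rfl⟩
    refine H.mul_mem hsH (ih l.length (by simp) l hl' ?_ rfl)
    rw [mul_smul] at hg
    rw [← hprod, mul_smul, mul_smul, hg, P.affineReflection_smul_eq_self hsv]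

/-! ### Passage to linear parts and the subsystem -/

theorem congruentialSubgroup_eq_closure [Finite ι] (P : RootPairing ι ℝ M N)
    [P.IsCrystallographic] (v : M) :
    P.congruentialSubgroup v = Subgroup.closure {ρ | ρ ∈ P.congruentialSubgroup v ∧
      ∃ i : ι, ρ = weylGroup.ofIdx P i} := by
  refine le_antisymm (fun ρ hρ ↦ ?_) ((Subgroup.closure_le _).mpr fun ρ hρ ↦ hρ.1)
  have hρ' : v - ρ • v ∈ P.rootLattice := by
    rw [← neg_sub]
    exact neg_mem hρ
  have hg := P.mem_closure_affineReflection_of_smul_eq (v := v)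
    (g := ⟨Multiplicative.ofAdd ⟨_, hρ'⟩, ρ⟩) (add_sub_cancel (ρ • v) v)
  have := Subgroup.mem_map_of_mem SemidirectProduct.rightHom hg
  rw [MonoidHom.map_closure] at this
  refine Subgroup.closure_mono ?_ this
  rintro - ⟨-, ⟨j, hj, rfl⟩, rfl⟩
  refine ⟨?_, j.1, rfl⟩
  have hfix := P.affineReflection_smul_eq_self hj
  rw [affineWeylGroup_smul_def] at hfix
  change (P.affineReflection j).right • v - v ∈ P.rootLattice
  rw [← eq_sub_iff_add_eq] at hfix
  rw [hfix, sub_sub_cancel_left]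
  exact neg_mem (Multiplicative.toAdd (P.affineReflection j).left).2

theorem isCrystallographic_subsystem (P : RootPairing ι ℝ M N) [P.IsCrystallographic]
    (H : Subgroup P.weylGroup) : (P.subsystem H).IsCrystallographic :=
  ⟨fun i j ↦ P.exists_value (S := ℤ) i.1 j.1⟩

theorem toModuleAut_weylGroup_injective (P : RootPairing ι ℝ M N) :
    Function.Injective (DistribMulAction.toModuleAut ℝ M : P.weylGroup →* M ≃ₗ[ℝ] M) :=
  fun _ _ h ↦ P.weylGroup_eq_of_smul_eq fun x ↦ LinearEquiv.congr_fun h x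

theorem range_toModuleAut_weylGroup (P : RootPairing ι ℝ M N) :
    (DistribMulAction.toModuleAut ℝ M : P.weylGroup →* M ≃ₗ[ℝ] M).range =
      Subgroup.closure (Set.range P.reflection) := by
  rw [← range_weylGroup_weightHom]
  rfl

/-- Both groups act faithfully on `M`, and their images in `GL(M)` are generated by the same
reflections. The generation hypothesis on `H` is what makes its image no larger. -/
theorem exists_weylGroup_subsystem_mulEquiv (P : RootPairing ι ℝ M N) {H : Subgroup P.weylGroup}
    (hH : H = Subgroup.closure {ρ | ρ ∈ H ∧ ∃ i : ι, ρ = weylGroup.ofIdx P i}) :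
    ∃ e : (P.subsystem H).weylGroup ≃* H,
      ∀ (g : (P.subsystem H).weylGroup) (x : M), (e g : P.weylGroup) • x = g • x := by
  let f : (P.subsystem H).weylGroup →* M ≃ₗ[ℝ] M := DistribMulAction.toModuleAut ℝ M
  let f' : H →* M ≃ₗ[ℝ] M := (DistribMulAction.toModuleAut ℝ M).comp H.subtype
  have hf : Function.Injective f := (P.subsystem H).toModuleAut_weylGroup_injective
  have hf' : Function.Injective f' :=
    P.toModuleAut_weylGroup_injective.comp H.subtype_injective
  have hrange : f.range = f'.range := by
    rw [range_toModuleAut_weylGroup, MonoidHom.range_comp, Subgroup.range_subtype]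
    conv_rhs => rw [hH, MonoidHom.map_closure]
    congr 1
    ext φ
    constructor
    · rintro ⟨i, rfl⟩
      exact ⟨_, ⟨i.2, i.1, rfl⟩, LinearEquiv.ext fun _ ↦ rfl⟩
    · rintro ⟨-, ⟨hi, i, rfl⟩, rfl⟩
      exact ⟨⟨i, hi⟩, LinearEquiv.ext fun _ ↦ rfl⟩
  refine ⟨(MonoidHom.ofInjective hf).trans
    ((MulEquiv.subgroupCongr hrange).trans (MonoidHom.ofInjective hf').symm), fun g x ↦ ?_⟩
  have h : f' ((MonoidHom.ofInjective hf').symm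
      (MulEquiv.subgroupCongr hrange (MonoidHom.ofInjective hf g))) = f g := by
    rw [MonoidHom.apply_ofInjective_symm]
    rfl
  exact LinearEquiv.congr_fun h x

theorem exists_stabilizer_mulEquiv_congruentialSubgroup (P : RootPairing ι ℝ M N) (v : M) :
    ∃ e : MulAction.stabilizer P.AffineWeylGroup v ≃* P.congruentialSubgroup v,
      ∀ g : MulAction.stabilizer P.AffineWeylGroup v,
        (e g : P.weylGroup) = (g : P.AffineWeylGroup).right := by
  have hfix (g : MulAction.stabilizer P.AffineWeylGroup v) :
      ((Multiplicative.toAdd (g : P.AffineWeylGroup).left : P.rootLattice) : M) =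
        v - (g : P.AffineWeylGroup).right • v := by
    rw [eq_sub_iff_add_eq']
    exact g.2
  let f : MulAction.stabilizer P.AffineWeylGroup v →* P.congruentialSubgroup v :=
    (SemidirectProduct.rightHom.comp (Subgroup.subtype _)).codRestrict _ fun g ↦ by
      change (g : P.AffineWeylGroup).right • v - v ∈ P.rootLattice
      rw [← neg_sub, ← hfix]
      exact neg_mem (Multiplicative.toAdd (g : P.AffineWeylGroup).left).2
  refine ⟨MulEquiv.ofBijective f ⟨fun g h hgh ↦ ?_, fun ρ ↦ ?_⟩, fun g ↦ rfl⟩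
  · have hright : (g : P.AffineWeylGroup).right = (h : P.AffineWeylGroup).right :=
      congrArg Subtype.val hgh
    refine Subtype.ext (SemidirectProduct.ext (Subtype.ext ?_) hright)
    exact (hfix g).trans ((congrArg (fun w ↦ v - w • v) hright).trans (hfix h).symm)
  · have hρ : v - (ρ : P.weylGroup) • v ∈ P.rootLattice := by
      rw [← neg_sub]
      exact neg_mem ρ.2
    exact ⟨⟨⟨Multiplicative.ofAdd ⟨_, hρ⟩, ρ⟩, add_sub_cancel ((ρ : P.weylGroup) • v) v⟩, rfl⟩

end RootPairing

theorem theorem2p1 {ι M N : Type*} [Finite ι] [AddCommGroup M] [Module ℝ M] [AddCommGroup N]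
    [Module ℝ N] (P : RootPairing ι ℝ M N) [P.IsCrystallographic]
    (v : M) (hv : v ∈ P.rootSpan ℝ) :
    -- `W^{v+Λ_a}` is generated by the reflections in roots that it contains
    P.congruentialSubgroup v =
        Subgroup.closure {ρ | ρ ∈ P.congruentialSubgroup v ∧
          ∃ i : ι, ρ = RootPairing.weylGroup.ofIdx P i} ∧
    -- the roots of these reflections form a crystallographic root system, whose Weyl group is
    -- `W^{v+Λ_a}` (as groups of transformations of `M`)
    (P.subsystem (P.congruentialSubgroup v)).IsCrystallographic ∧
    (∃ e : (P.subsystem (P.congruentialSubgroup v)).weylGroup ≃* P.congruentialSubgroup v,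
      ∀ (g : (P.subsystem (P.congruentialSubgroup v)).weylGroup) (x : M),
        (e g : P.weylGroup) • x = g • x) ∧
    -- taking linear parts is an isomorphism from the stabilizer of `v` in `W ⋉ Λ_a`
    (∃ e : MulAction.stabilizer P.AffineWeylGroup v ≃* P.congruentialSubgroup v,
      ∀ g : MulAction.stabilizer P.AffineWeylGroup v,
        (e g : P.weylGroup) = (g : P.AffineWeylGroup).right) :=
  ⟨P.congruentialSubgroup_eq_closure v, P.isCrystallographic_subsystem _,
    P.exists_weylGroup_subsystem_mulEquiv (P.congruentialSubgroup_eq_closure v),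
    P.exists_stabilizer_mulEquiv_congruentialSubgroup v⟩
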